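/- A simple arrangement of $n$ pairwise intersecting pseudocircles is a collection of $n$ simple closed curves (pseudocircles) in the plane such that any two of them either touch in a single point, and have no other common point, or intersect in exactly two points, at both of which they cross, and such that no three of the curves have a common point. Its touching graph has the curves as vertices, and two curves are adjacent if and only if they touch. For $n \in \{11, 14, 15\}$ and for every integer $n \ge 17$ there exists a simple arrangement of $n$ pairwise intersecting pseudocircles whose touching graph contains no triangle and which has exactly $2n-2$ touchings. -/

import Mathlib

/-- A simple closed curve in the plane: the image of a continuous injective map defined on the
unit circle. Only the topology of the plane `ℝ × ℝ` is used here and below. -/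
def IsSimpleClosedCurve (C : Set (ℝ × ℝ)) : Prop :=
  ∃ f : Circle → ℝ × ℝ, Continuous f ∧ Function.Injective f ∧ Set.range f = C

/-- `C` and `D` cross at `p`: some local homeomorphism of the plane at `p` takes `p` to the
origin, `C` to the horizontal axis and `D` to the vertical axis. -/
def CrossAt (C D : Set (ℝ × ℝ)) (p : ℝ × ℝ) : Prop :=
  ∃ e : OpenPartialHomeomorph (ℝ × ℝ) (ℝ × ℝ), p ∈ e.source ∧ e p = (0, 0) ∧
    ∀ z ∈ e.source, (z ∈ C ↔ (e z).2 = 0) ∧ (z ∈ D ↔ (e z).1 = 0)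

/-- `C` and `D` touch at `p`: some local homeomorphism of the plane at `p` takes `p` to the
origin, `C` to the horizontal axis and `D` to the graph `y = |x|`, which meets the axis only at
the origin and stays on one side of it. -/
def TouchAt (C D : Set (ℝ × ℝ)) (p : ℝ × ℝ) : Prop :=
  ∃ e : OpenPartialHomeomorph (ℝ × ℝ) (ℝ × ℝ), p ∈ e.source ∧ e p = (0, 0) ∧
    ∀ z ∈ e.source, (z ∈ C ↔ (e z).2 = 0) ∧ (z ∈ D ↔ (e z).2 = |(e z).1|)

/-- `C` and `D` touch in a single point and have no other common point. -/
def Touch (C D : Set (ℝ × ℝ)) : Prop :=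
  ∃ p, C ∩ D = {p} ∧ TouchAt C D p

/-- `C` and `D` intersect in exactly two points, and they cross at both of them. -/
def CrossTwice (C D : Set (ℝ × ℝ)) : Prop :=
  ∃ p q, p ≠ q ∧ C ∩ D = {p, q} ∧ CrossAt C D p ∧ CrossAt C D q

/-- The homeomorphism `(x, y) ↦ (x, |x| - y)` of the plane, which exchanges the horizontal axis
and the graph `y = |x|`. -/
def absFlip : (ℝ × ℝ) ≃ₜ (ℝ × ℝ) where
  toFun z := (z.1, |z.1| - z.2)
  invFun z := (z.1, |z.1| - z.2)
  left_inv z := by simp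
  right_inv z := by simp
  continuous_toFun := by fun_prop
  continuous_invFun := by fun_prop

theorem TouchAt.symm {C D : Set (ℝ × ℝ)} {p : ℝ × ℝ} (h : TouchAt C D p) : TouchAt D C p := by
  obtain ⟨e, hp, h0, he⟩ := h
  refine ⟨e.trans absFlip.toOpenPartialHomeomorph, by simpa using hp, by simp [h0, absFlip], ?_⟩
  intro z hz
  have hz' : z ∈ e.source := by simpa using hz
  obtain ⟨h1, h2⟩ := he z hz'
  constructor
  · rw [h2]
    simp only [OpenPartialHomeomorph.coe_trans, Homeomorph.toOpenPartialHomeomorph_apply,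
      Function.comp_apply, absFlip, Homeomorph.homeomorph_mk_coe, Equiv.coe_fn_mk, sub_eq_zero]
    exact eq_comm
  · rw [h1]
    simp [absFlip]

theorem Touch.symm {C D : Set (ℝ × ℝ)} (h : Touch C D) : Touch D C := by
  obtain ⟨p, hp, ht⟩ := h
  exact ⟨p, by rw [Set.inter_comm, hp], ht.symm⟩

/-- The curves `C 0, …, C (n - 1)` form a simple arrangement of `n` pairwise intersecting
pseudocircles in the plane. -/
structure IsSimpleArrangement {n : ℕ} (C : Fin n → Set (ℝ × ℝ)) : Prop where
  isSimpleClosedCurve : ∀ i, IsSimpleClosedCurve (C i)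
  touch_or_crossTwice : ∀ i j, i ≠ j → Touch (C i) (C j) ∨ CrossTwice (C i) (C j)
  no_triple_point : ∀ i j k, i ≠ j → j ≠ k → i ≠ k → C i ∩ C j ∩ C k = ∅

/-- The touching graph: its vertices are the curves, and two of them are adjacent when they
touch. -/
def touchingGraph {n : ℕ} (C : Fin n → Set (ℝ × ℝ)) : SimpleGraph (Fin n) where
  Adj i j := i ≠ j ∧ Touch (C i) (C j)
  symm := ⟨fun _ _ h => ⟨h.1.symm, h.2.symm⟩⟩
  loopless := ⟨fun _ h => h.1 rfl⟩

/-- The set of all touching points of a family of curves. -/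
def touchings {n : ℕ} (C : Fin n → Set (ℝ × ℝ)) : Set (ℝ × ℝ) :=
  {p | ∃ i j, i ≠ j ∧ C i ∩ C j = {p} ∧ TouchAt (C i) (C j) p}

/-!
All curves used here are circles.

*One more curve.* Suppose that in an arrangement of circles the circle `c` touches `d` and `e`,
which do not touch each other. The circles that touch `d` and `e` on the same sides as `c` does
form a one-parameter family through `c`. A member of this family near `c`, on the appropriate side
of it, touches `d` and `e` and crosses every other circle, `c` included: where `c` crosses a circle
it does so too, and where `c` touches a third circle it has moved into that circle. As `d` and `e`
do not touch each other, this creates no triangle in the touching graph. It adds one curve and two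
touchings, so it preserves the equation between the number of touchings and `2n - 2`. Two members
of the family cross each other, and only finitely many of them pass through a given point; hence
triple points can be avoided, and the step can be repeated with the same `c`, `d`, `e`
(`SignedCircle.pencil`, `SignedCircle.IsArrangement.cons`, `SignedCircle.exists_isArrangement`).

*Eleven curves.* The Grötzsch graph has 11 vertices, 20 edges and no triangle. It is the touching
graph of eleven circles with rational centres and radii (`SignedCircle.groetzsch`), so that
tangency, crossing and the absence of triple points amount to finitely many identities and
inequalities between rational numbers, which are decided by evaluation.

*Circles as curves.* The criteria for tangency and crossing in terms of centres and radii imply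
the topological notions `Touch` and `CrossTwice`: the inverse function theorem, applied to suitable
polynomials, provides the local coordinates (`SignedCircle.Tangent.touch`,
`SignedCircle.Crosses.crossTwice`).
-/

/-! ### Circles with a signed radius -/

/-- A circle with centre `(x, y)` and signed radius `r`. A negative radius encodes the same curve,
with the exterior as its distinguished side; so one equation, `SignedCircle.Tangent`, covers both
external and internal tangency. -/
structure SignedCircle (R : Type*) where
  /-- The abscissa of the centre. -/
  x : R
  /-- The ordinate of the centre. -/
  y : R
  /-- The signed radius. -/
  r : R

namespace SignedCircle

section Algebra

variable {R : Type*} [CommRing R]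

/-- The quantity `d² - r² - s²`, where `d` is the distance of the centres of two circles and
`r`, `s` are their radii. -/
def gap (c d : SignedCircle R) : R :=
  (c.x - d.x) ^ 2 + (c.y - d.y) ^ 2 - c.r ^ 2 - d.r ^ 2

/-- The distinguished sides of `c` and `d` are externally tangent: `d² = (r + s)²`. The condition
`r + s ≠ 0` excludes that the two circles are the same curve. -/
def Tangent (c d : SignedCircle R) : Prop :=
  gap c d = 2 * c.r * d.r ∧ c.r + d.r ≠ 0

/-- The circles cross at two points: `(|r| - |s|)² < d² < (|r| + |s|)²`. -/
def Crosses [LT R] (c d : SignedCircle R) : Prop :=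
  gap c d ^ 2 < 4 * c.r ^ 2 * d.r ^ 2

/-- This vanishes if the three circles have a common point. With that point at `u` from the
centre of `c`, the other two equations are linear in `u`; solving them by Cramer's rule and
substituting in `|u|² = r²` gives this expression. -/
def concurrence (c d e : SignedCircle ℚ) : ℚ :=
  let A := d.x - c.x
  let B := d.y - c.y
  let A' := e.x - c.x
  let B' := e.y - c.y
  let P := (A ^ 2 + B ^ 2 + c.r ^ 2 - d.r ^ 2) / 2
  let P' := (A' ^ 2 + B' ^ 2 + c.r ^ 2 - e.r ^ 2) / 2
  (P * B' - P' * B) ^ 2 + (A * P' - A' * P) ^ 2 - c.r ^ 2 * (A * B' - A' * B) ^ 2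

instance [DecidableEq R] (c d : SignedCircle R) : Decidable (Tangent c d) :=
  inferInstanceAs (Decidable (_ ∧ _))

instance (c d : SignedCircle ℚ) : Decidable (Crosses c d) :=
  inferInstanceAs (Decidable (_ < _))

theorem gap_comm (c d : SignedCircle R) : gap c d = gap d c := by
  unfold gap; ring

theorem Tangent.symm {c d : SignedCircle R} (h : Tangent c d) : Tangent d c :=
  ⟨by rw [gap_comm, h.1]; ring, by rw [add_comm]; exact h.2⟩

theorem Crosses.symm [LT R] {c d : SignedCircle R} (h : Crosses c d) : Crosses d c := by
  unfold Crosses at *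
  rw [gap_comm]
  convert h using 1
  ring

end Algebra

/-- The real circle given by rational data. -/
def toReal (c : SignedCircle ℚ) : SignedCircle ℝ := ⟨c.x, c.y, c.r⟩

theorem tangent_toReal {c d : SignedCircle ℚ} : Tangent c.toReal d.toReal ↔ Tangent c d := by
  simp only [Tangent, gap, toReal]
  norm_cast

theorem crosses_toReal {c d : SignedCircle ℚ} : Crosses c.toReal d.toReal ↔ Crosses c d := by
  simp only [Crosses, gap, toReal]
  norm_cast

/-- The power of the point `z` with respect to the circle `c`. -/
def power (c : SignedCircle ℝ) (z : ℝ × ℝ) : ℝ :=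
  (z.1 - c.x) ^ 2 + (z.2 - c.y) ^ 2 - c.r ^ 2

/-- The points of a circle. -/
def curve (c : SignedCircle ℝ) : Set (ℝ × ℝ) := {z | c.power z = 0}

theorem mem_curve {c : SignedCircle ℝ} {z : ℝ × ℝ} : z ∈ c.curve ↔ c.power z = 0 := Iff.rfl

theorem isSimpleClosedCurve_curve {c : SignedCircle ℝ} (hc : c.r ≠ 0) :
    IsSimpleClosedCurve c.curve := by
  refine ⟨fun z => (c.x + c.r * (z : ℂ).re, c.y + c.r * (z : ℂ).im), ?_, ?_, ?_⟩
  · have h : Continuous fun z : Circle => (z : ℂ) := continuous_subtype_val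
    have h1 := Complex.continuous_re.comp h
    have h2 := Complex.continuous_im.comp h
    exact (continuous_const.add (continuous_const.mul h1)).prodMk
      (continuous_const.add (continuous_const.mul h2))
  · intro z w h
    simp only [Prod.mk.injEq, add_right_inj, mul_eq_mul_left_iff, hc, or_false] at h
    exact Circle.ext (Complex.ext h.1 h.2)
  · ext p
    simp only [Set.mem_range, mem_curve, power]
    constructor
    · rintro ⟨z, rfl⟩
      have h : (z : ℂ).re * (z : ℂ).re + (z : ℂ).im * (z : ℂ).im = 1 := by
        rw [← Complex.normSq_apply, Circle.normSq_coe]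
      linear_combination c.r ^ 2 * h
    · intro h
      have h1 : (⟨(p.1 - c.x) / c.r, (p.2 - c.y) / c.r⟩ : ℂ) ∈ Submonoid.unitSphere ℂ := by
        rw [Submonoid.unitSphere, Submonoid.mem_mk, Subsemigroup.mem_mk,
          mem_sphere_zero_iff_norm, ← sq_eq_sq₀ (norm_nonneg _) zero_le_one,
          ← Complex.normSq_eq_norm_sq, Complex.normSq_mk]
        field_simp
        linear_combination h
      refine ⟨⟨_, h1⟩, ?_⟩
      ext <;> simp <;> field_simp <;> ring

theorem concurrence_eq_zero {c d e : SignedCircle ℚ} {z : ℝ × ℝ} (hc : z ∈ c.toReal.curve)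
    (hd : z ∈ d.toReal.curve) (he : z ∈ e.toReal.curve) : concurrence c d e = 0 := by
  have h : ((concurrence c d e : ℚ) : ℝ) = 0 := by
    simp only [mem_curve, power, toReal] at hc hd he
    simp only [concurrence]
    push_cast
    set u := z.1 - (c.x : ℝ) with hu
    set v := z.2 - (c.y : ℝ) with hv
    set A : ℝ := (d.x : ℝ) - c.x with hA
    set B : ℝ := (d.y : ℝ) - c.y with hB
    set A' : ℝ := (e.x : ℝ) - c.x with hA'
    set B' : ℝ := (e.y : ℝ) - c.y with hB'
    have h1 : (A ^ 2 + B ^ 2 + (c.r : ℝ) ^ 2 - (d.r : ℝ) ^ 2) / 2 = A * u + B * v := by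
      rw [hA, hB, hu, hv]; linear_combination (hd - hc) / 2
    have h2 : (A' ^ 2 + B' ^ 2 + (c.r : ℝ) ^ 2 - (e.r : ℝ) ^ 2) / 2 = A' * u + B' * v := by
      rw [hA', hB', hu, hv]; linear_combination (he - hc) / 2
    rw [h1, h2]
    linear_combination (A * B' - A' * B) ^ 2 * hc
  exact_mod_cast h

/-! ### Tangent circles touch and crossing circles cross -/

/-- The inverse function theorem in the plane: two functions with independent gradients at `p`
are the coordinates of a local homeomorphism. -/
theorem exists_openPartialHomeomorph {f g : ℝ × ℝ → ℝ} {p : ℝ × ℝ} {f' g' : ℝ × ℝ →L[ℝ] ℝ}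
    (hf : HasStrictFDerivAt f f' p) (hg : HasStrictFDerivAt g g' p)
    (hdet : f' (1, 0) * g' (0, 1) - f' (0, 1) * g' (1, 0) ≠ 0) :
    ∃ e : OpenPartialHomeomorph (ℝ × ℝ) (ℝ × ℝ), p ∈ e.source ∧ ∀ z, e z = (f z, g z) := by
  have key (φ : ℝ × ℝ →L[ℝ] ℝ) (z : ℝ × ℝ) : φ z = φ (1, 0) * z.1 + φ (0, 1) * z.2 := by
    have : z = z.1 • (1, 0) + z.2 • (0, 1) := by ext <;> simp
    conv_lhs => rw [this, map_add, map_smul, map_smul]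
    simp [mul_comm]
  have hinj : Function.Injective (f'.prod g') := by
    rw [injective_iff_map_eq_zero]
    intro z hz
    simp only [ContinuousLinearMap.prod_apply, Prod.mk_eq_zero] at hz
    obtain ⟨h1, h2⟩ := hz
    rw [key] at h1 h2
    have e1 : (f' (1, 0) * g' (0, 1) - f' (0, 1) * g' (1, 0)) * z.1 = 0 := by
      linear_combination g' (0, 1) * h1 - f' (0, 1) * h2
    have e2 : (f' (1, 0) * g' (0, 1) - f' (0, 1) * g' (1, 0)) * z.2 = 0 := by
      linear_combination f' (1, 0) * h2 - g' (1, 0) * h1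
    ext
    · simpa [hdet] using e1
    · simpa [hdet] using e2
  let E : (ℝ × ℝ) ≃L[ℝ] (ℝ × ℝ) :=
    (LinearEquiv.ofInjectiveEndo (f'.prod g' : ℝ × ℝ →ₗ[ℝ] ℝ × ℝ) hinj).toContinuousLinearEquiv
  have hE : (E : ℝ × ℝ →L[ℝ] ℝ × ℝ) = f'.prod g' := by
    ext <;> rfl
  have hfg : HasStrictFDerivAt (fun z => (f z, g z)) (E : ℝ × ℝ →L[ℝ] ℝ × ℝ) p := by
    rw [hE]; exact hf.prodMk hg
  exact ⟨hfg.toOpenPartialHomeomorph _, hfg.mem_toOpenPartialHomeomorph_source, fun _ => rfl⟩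

theorem hasStrictFDerivAt_power (c : SignedCircle ℝ) (p : ℝ × ℝ) :
    HasStrictFDerivAt c.power
      ((2 * (p.1 - c.x)) • ContinuousLinearMap.fst ℝ ℝ ℝ +
        (2 * (p.2 - c.y)) • ContinuousLinearMap.snd ℝ ℝ ℝ) p := by
  have h1 : HasStrictFDerivAt (fun z : ℝ × ℝ => z.1 - c.x) (ContinuousLinearMap.fst ℝ ℝ ℝ) p :=
    hasStrictFDerivAt_fst.sub_const _
  have h2 : HasStrictFDerivAt (fun z : ℝ × ℝ => z.2 - c.y) (ContinuousLinearMap.snd ℝ ℝ ℝ) p :=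
    hasStrictFDerivAt_snd.sub_const _
  refine (((h1.pow 2).add (h2.pow 2)).sub_const (c.r ^ 2)).congr_fderiv ?_
  ext <;> simp

theorem crossAt_of_power_eq_zero {c d : SignedCircle ℝ} {p : ℝ × ℝ} (hc : c.power p = 0)
    (hd : d.power p = 0)
    (h : (p.1 - c.x) * (p.2 - d.y) - (p.2 - c.y) * (p.1 - d.x) ≠ 0) :
    CrossAt c.curve d.curve p := by
  obtain ⟨e, hp, he⟩ := exists_openPartialHomeomorph (d.hasStrictFDerivAt_power p)
    (c.hasStrictFDerivAt_power p) (by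
      simp only [add_apply, smul_apply,
        ContinuousLinearMap.coe_fst', ContinuousLinearMap.coe_snd', smul_eq_mul]
      contrapose! h
      linear_combination -h / 4)
  exact ⟨e, hp, by rw [he, hc, hd], fun z _ => by rw [he]; exact ⟨Iff.rfl, Iff.rfl⟩⟩

theorem Crosses.crossTwice {c d : SignedCircle ℝ} (h : Crosses c d) :
    CrossTwice c.curve d.curve := by
  obtain ⟨x, y, r⟩ := c
  obtain ⟨x', y', s⟩ := d
  unfold Crosses gap at h
  simp only at h
  obtain ⟨u, rfl⟩ : ∃ u, x' = x + u := ⟨x' - x, by ring⟩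
  obtain ⟨v, rfl⟩ : ∃ v, y' = y + v := ⟨y' - y, by ring⟩
  have hD : 0 < u ^ 2 + v ^ 2 := by
    by_contra! hD
    have hD0 : u ^ 2 + v ^ 2 = 0 := le_antisymm hD (by positivity)
    have : ((x - (x + u)) ^ 2 + (y - (y + v)) ^ 2 - r ^ 2 - s ^ 2) ^ 2 - 4 * r ^ 2 * s ^ 2
        = (r ^ 2 - s ^ 2) ^ 2 := by
      linear_combination (u ^ 2 + v ^ 2 - 2 * (r ^ 2 + s ^ 2)) * hD0
    nlinarith [sq_nonneg (r ^ 2 - s ^ 2)]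
  -- In the frame of the centres, the common points are at `α` along the line of the centres
  -- and at `± β` across it.
  obtain ⟨α, hα⟩ : ∃ α, 2 * (u ^ 2 + v ^ 2) * α = u ^ 2 + v ^ 2 + r ^ 2 - s ^ 2 :=
    ⟨(u ^ 2 + v ^ 2 + r ^ 2 - s ^ 2) / (2 * (u ^ 2 + v ^ 2)), by field_simp⟩
  have hβ0 : 0 < r ^ 2 / (u ^ 2 + v ^ 2) - α ^ 2 := by
    have h1 : 0 < 4 * (u ^ 2 + v ^ 2) ^ 2 * (r ^ 2 / (u ^ 2 + v ^ 2) - α ^ 2) := by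
      have : 4 * (u ^ 2 + v ^ 2) ^ 2 * (r ^ 2 / (u ^ 2 + v ^ 2) - α ^ 2)
          = 4 * (u ^ 2 + v ^ 2) * r ^ 2 - (2 * (u ^ 2 + v ^ 2) * α) ^ 2 := by
        field_simp
        ring
      rw [this, hα]
      nlinarith
    exact pos_of_mul_pos_right h1 (by positivity)
  obtain ⟨β, hβ, hβ2⟩ : ∃ β, 0 < β ∧ (u ^ 2 + v ^ 2) * (α ^ 2 + β ^ 2) = r ^ 2 := by
    refine ⟨_, Real.sqrt_pos.2 hβ0, ?_⟩
    rw [Real.sq_sqrt hβ0.le]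
    field_simp
    ring
  have hmem (t : ℝ) (ht : t ^ 2 = β ^ 2) :
      power ⟨x, y, r⟩ (x + (α * u - t * v), y + (α * v + t * u)) = 0 ∧
      power ⟨x + u, y + v, s⟩ (x + (α * u - t * v), y + (α * v + t * u)) = 0 := by
    constructor
    · simp only [power]
      linear_combination hβ2 + (u ^ 2 + v ^ 2) * ht
    · simp only [power]
      linear_combination hβ2 + (u ^ 2 + v ^ 2) * ht - hα
  have hcross (t : ℝ) (ht : t ^ 2 = β ^ 2) :
      CrossAt (curve ⟨x, y, r⟩) (curve ⟨x + u, y + v, s⟩)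
        (x + (α * u - t * v), y + (α * v + t * u)) := by
    refine crossAt_of_power_eq_zero (hmem t ht).1 (hmem t ht).2 ?_
    have ht0 : t ≠ 0 := by
      rintro rfl
      have : 0 < β ^ 2 := by positivity
      linarith
    have : t * (u ^ 2 + v ^ 2) ≠ 0 := mul_ne_zero ht0 hD.ne'
    contrapose! this
    simp only at this
    linear_combination this
  refine ⟨(x + (α * u - β * v), y + (α * v + β * u)),
    (x + (α * u - -β * v), y + (α * v + -β * u)), ?_, ?_, hcross β rfl, hcross (-β) (by ring)⟩
  · intro heq
    simp only [Prod.mk.injEq] at heq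
    have : β * (u ^ 2 + v ^ 2) = 0 := by linear_combination (u * heq.2 - v * heq.1) / 2
    have : 0 < β * (u ^ 2 + v ^ 2) := by positivity
    linarith
  · apply Set.Subset.antisymm
    · rintro ⟨a, b⟩ ⟨h1, h2⟩
      simp only [mem_curve, power] at h1 h2
      have e1 : (u ^ 2 + v ^ 2) * ((a - x) * u + (b - y) * v - α * (u ^ 2 + v ^ 2)) = 0 := by
        linear_combination (u ^ 2 + v ^ 2) / 2 * (h1 - h2) - (u ^ 2 + v ^ 2) / 2 * hα
      have e1' : (a - x) * u + (b - y) * v - α * (u ^ 2 + v ^ 2) = 0 :=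
        (mul_eq_zero.1 e1).resolve_left hD.ne'
      have e2 : ((b - y) * u - (a - x) * v - β * (u ^ 2 + v ^ 2)) *
          ((b - y) * u - (a - x) * v + β * (u ^ 2 + v ^ 2)) = 0 := by
        linear_combination (u ^ 2 + v ^ 2) * h1 - (u ^ 2 + v ^ 2) * hβ2
          - ((a - x) * u + (b - y) * v + α * (u ^ 2 + v ^ 2)) * e1'
      have fin (t : ℝ) (e3 : (b - y) * u - (a - x) * v - t * (u ^ 2 + v ^ 2) = 0) :
          (a, b) = (x + (α * u - t * v), y + (α * v + t * u)) := by
        have f1 : (u ^ 2 + v ^ 2) * (a - (x + (α * u - t * v))) = 0 := by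
          linear_combination u * e1' - v * e3
        have f2 : (u ^ 2 + v ^ 2) * (b - (y + (α * v + t * u))) = 0 := by
          linear_combination v * e1' + u * e3
        ext
        · exact sub_eq_zero.1 ((mul_eq_zero.1 f1).resolve_left hD.ne')
        · exact sub_eq_zero.1 ((mul_eq_zero.1 f2).resolve_left hD.ne')
      rcases mul_eq_zero.1 e2 with e3 | e3
      · exact Or.inl (fin β e3)
      · exact Or.inr (fin (-β) (by linear_combination e3))
    · rintro z (rfl | rfl)
      · exact hmem β rfl
      · exact hmem (-β) (by ring)

/-- The homeomorphism `(x, y) ↦ (x |x|, y)` of the plane. It takes the parabola `y = x²` to the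
graph `y = |x|`. -/
noncomputable def squash : (ℝ × ℝ) ≃ₜ (ℝ × ℝ) where
  toFun z := (z.1 * |z.1|, z.2)
  invFun z := (√z.1 - √(-z.1), z.2)
  left_inv z := by
    ext
    · rcases le_total 0 z.1 with h | h
      · simp [abs_of_nonneg h, Real.sqrt_mul_self h, Real.sqrt_eq_zero_of_nonpos, mul_self_nonneg]
      · have h' : 0 ≤ -z.1 := by linarith
        have e : z.1 * |z.1| = -(-z.1 * -z.1) := by rw [abs_of_nonpos h]; ring
        simp only [e, neg_neg, Real.sqrt_mul_self h']
        rw [Real.sqrt_eq_zero_of_nonpos (by nlinarith)]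
        ring
    · rfl
  right_inv z := by
    ext
    · rcases le_total 0 z.1 with h | h
      · simp [Real.sqrt_eq_zero_of_nonpos (neg_nonpos.2 h), abs_of_nonneg (Real.sqrt_nonneg _), h]
      · simp [Real.sqrt_eq_zero_of_nonpos h, abs_of_nonneg (Real.sqrt_nonneg _), h]
    · rfl
  continuous_toFun := by fun_prop
  continuous_invFun := by fun_prop

/-- Circles with signed radii `a ≠ b` and common unit normal `m` at `p` touch at `p`. In the
orthonormal frame `(X, Y)` at `p` with `Y` along `m` their equations are `X² + Y² = 2aY` and
`X² + Y² = 2bY`. The polynomial coordinates `ξ = X` and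
`η = (X² + Y² - 2aY) (2b - Y) / (2 (b - a))` straighten the first one to `η = 0` and, as
`η - ξ² = (2a - Y) (X² + Y² - 2bY) / (2 (b - a))`, take the second one to `η = ξ²`. -/
theorem touchAt_of_common_normal {c d : SignedCircle ℝ} {p m : ℝ × ℝ} {a b : ℝ}
    (hm : m.1 ^ 2 + m.2 ^ 2 = 1) (ha : a ≠ 0) (hb : b ≠ 0) (hab : b - a ≠ 0)
    (hc : ∀ z, c.power z = (z.1 - p.1) ^ 2 + (z.2 - p.2) ^ 2
      - 2 * a * (m.1 * (z.1 - p.1) + m.2 * (z.2 - p.2)))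
    (hd : ∀ z, d.power z = (z.1 - p.1) ^ 2 + (z.2 - p.2) ^ 2
      - 2 * b * (m.1 * (z.1 - p.1) + m.2 * (z.2 - p.2))) :
    TouchAt c.curve d.curve p := by
  set X : ℝ × ℝ → ℝ := fun z => m.1 * (z.2 - p.2) - m.2 * (z.1 - p.1) with hX
  set Y : ℝ × ℝ → ℝ := fun z => m.1 * (z.1 - p.1) + m.2 * (z.2 - p.2) with hY
  set η : ℝ × ℝ → ℝ := fun z => c.power z * (2 * b - Y z) * (2 * (b - a))⁻¹ with hη
  have hp0 : c.power p = 0 := by rw [hc]; ring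
  have h1 : HasStrictFDerivAt (fun z : ℝ × ℝ => z.1 - p.1) (ContinuousLinearMap.fst ℝ ℝ ℝ) p :=
    hasStrictFDerivAt_fst.sub_const _
  have h2 : HasStrictFDerivAt (fun z : ℝ × ℝ => z.2 - p.2) (ContinuousLinearMap.snd ℝ ℝ ℝ) p :=
    hasStrictFDerivAt_snd.sub_const _
  have hX' := (h2.const_mul m.1).sub (h1.const_mul m.2)
  have hY' := (h1.const_mul m.1).add (h2.const_mul m.2)
  have hη' := ((c.hasStrictFDerivAt_power p).mul (hY'.const_sub (2 * b))).mul_const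
    (2 * (b - a))⁻¹
  have hYp : Y p = 0 := by simp [hY]
  have hXp : X p = 0 := by simp [hX]
  have hηp : η p = 0 := by simp [hη, hp0]
  -- The gradient of the power at `p`.
  have hg1 : 2 * (p.1 - c.x) = -(2 * a * m.1) := by
    have e1 := hc (p.1 + 1, p.2)
    have e2 := hc (p.1 - 1, p.2)
    simp only [power] at e1 e2
    linear_combination (e1 - e2) / 2
  have hg2 : 2 * (p.2 - c.y) = -(2 * a * m.2) := by
    have e1 := hc (p.1, p.2 + 1)
    have e2 := hc (p.1, p.2 - 1)
    simp only [power] at e1 e2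
    linear_combination (e1 - e2) / 2
  obtain ⟨e, hpe, he⟩ := exists_openPartialHomeomorph (f := X) (g := η) hX' hη' (by
    have e1 : (2 * a) * (2 * b) * (2 * (b - a))⁻¹ ≠ 0 := by simp [ha, hb, hab]
    simp only [hp0, hg1, hg2]
    simp only [add_apply, sub_apply, smul_apply, neg_apply, ContinuousLinearMap.coe_fst',
      ContinuousLinearMap.coe_snd', smul_eq_mul, Pi.add_apply]
    contrapose! e1
    linear_combination e1 - (2 * a) * (2 * b) * (2 * (b - a))⁻¹ * hm)
  have hYc : Continuous Y := by fun_prop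
  -- Away from these lines the factors `2a - Y` and `2b - Y` do not vanish.
  have hU : IsOpen {z | 2 * a - Y z ≠ 0 ∧ 2 * b - Y z ≠ 0} :=
    (isOpen_ne_fun (by fun_prop) (by fun_prop)).inter (isOpen_ne_fun (by fun_prop) (by fun_prop))
  refine ⟨(e.restrOpen _ hU).trans squash.toOpenPartialHomeomorph, ?_, ?_, ?_⟩
  · simpa [hYp, ha, hb] using hpe
  · simp [he, squash, hXp, hηp]
  · intro z hz
    have hz' : z ∈ e.source ∧ 2 * a - Y z ≠ 0 ∧ 2 * b - Y z ≠ 0 := by simpa using hz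
    obtain ⟨-, hza, hzb⟩ := hz'
    have ez : ((e.restrOpen _ hU).trans squash.toOpenPartialHomeomorph) z
        = (X z * |X z|, η z) := by simp [he, squash]
    rw [ez]
    constructor
    · simp [mem_curve, hη, hzb, hab]
    · have hXY : (z.1 - p.1) ^ 2 + (z.2 - p.2) ^ 2 = X z ^ 2 + Y z ^ 2 := by
        simp only [hX, hY]
        linear_combination -((z.1 - p.1) ^ 2 + (z.2 - p.2) ^ 2) * hm
      have key : η z - X z ^ 2 = (2 * a - Y z) * d.power z * (2 * (b - a))⁻¹ := by
        have e1 : (2 * (b - a)) * (2 * (b - a))⁻¹ = 1 := mul_inv_cancel₀ (by simp [hab])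
        have e2 : c.power z = X z ^ 2 + Y z ^ 2 - 2 * a * Y z := by rw [hc, hXY]
        have e3 : d.power z = X z ^ 2 + Y z ^ 2 - 2 * b * Y z := by rw [hd, hXY]
        simp only [hη]
        rw [e2, e3]
        linear_combination X z ^ 2 * e1
      have habs : |(X z * |X z|)| = X z ^ 2 := by rw [abs_mul, abs_abs, abs_mul_abs_self, sq]
      simp only [habs, mem_curve]
      rw [← sub_eq_zero (a := η z), key]
      simp [hza, hab]

theorem Tangent.touch {c d : SignedCircle ℝ} (h : Tangent c d) (hc : c.r ≠ 0) (hd : d.r ≠ 0) :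
    Touch c.curve d.curve := by
  obtain ⟨x, y, r⟩ := c
  obtain ⟨x', y', s⟩ := d
  obtain ⟨h, hrs⟩ := h
  simp only [gap] at h hc hd hrs
  -- The unit normal `(m₁, m₂)` at the touching point is along the line of the centres.
  obtain ⟨m₁, rfl⟩ : ∃ m, x' = x + (r + s) * m := ⟨(x' - x) / (r + s), by field_simp; ring⟩
  obtain ⟨m₂, rfl⟩ : ∃ m, y' = y + (r + s) * m := ⟨(y' - y) / (r + s), by field_simp; ring⟩
  have hm : m₁ ^ 2 + m₂ ^ 2 = 1 := by
    have : (r + s) ^ 2 * (m₁ ^ 2 + m₂ ^ 2 - 1) = 0 := by linear_combination h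
    linarith [(mul_eq_zero.1 this).resolve_left (pow_ne_zero 2 hrs)]
  have hp1 : ∀ z : ℝ × ℝ, power ⟨x, y, r⟩ z = (z.1 - (x + r * m₁)) ^ 2 + (z.2 - (y + r * m₂)) ^ 2
      - 2 * (-r) * (m₁ * (z.1 - (x + r * m₁)) + m₂ * (z.2 - (y + r * m₂))) := fun z => by
    simp only [power]
    linear_combination r ^ 2 * hm
  have hp2 : ∀ z : ℝ × ℝ, power ⟨x + (r + s) * m₁, y + (r + s) * m₂, s⟩ z
      = (z.1 - (x + r * m₁)) ^ 2 + (z.2 - (y + r * m₂)) ^ 2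
      - 2 * s * (m₁ * (z.1 - (x + r * m₁)) + m₂ * (z.2 - (y + r * m₂))) := fun z => by
    simp only [power]
    linear_combination s ^ 2 * hm
  refine ⟨(x + r * m₁, y + r * m₂), ?_, touchAt_of_common_normal (m := (m₁, m₂)) (a := -r) (b := s)
    hm (neg_ne_zero.2 hc) hd (by rwa [sub_neg_eq_add, add_comm]) hp1 hp2⟩
  apply Set.Subset.antisymm
  · rintro ⟨a, b⟩ ⟨h1, h2⟩
    simp only [mem_curve, hp1, hp2] at h1 h2
    have e1 : (r + s) * (m₁ * (a - (x + r * m₁)) + m₂ * (b - (y + r * m₂))) = 0 := by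
      linear_combination (h1 - h2) / 2
    have e2 := (mul_eq_zero.1 e1).resolve_left hrs
    have e3 : (a - (x + r * m₁)) ^ 2 + (b - (y + r * m₂)) ^ 2 = 0 := by
      linear_combination h1 - 2 * r * e2
    have e4 : a - (x + r * m₁) = 0 := by nlinarith [sq_nonneg (b - (y + r * m₂))]
    have e5 : b - (y + r * m₂) = 0 := by nlinarith [sq_nonneg (a - (x + r * m₁))]
    ext
    · exact sub_eq_zero.1 e4
    · exact sub_eq_zero.1 e5
  · rintro z rfl
    simp only [Set.mem_inter_iff, mem_curve, hp1, hp2]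
    constructor <;> ring

end SignedCircle

/-! ### Arrangements of circles -/

namespace SignedCircle

open Filter Topology

theorem not_touch_of_crosses {c d : SignedCircle ℝ} (h : Crosses c d) (p : ℝ × ℝ) :
    c.curve ∩ d.curve ≠ {p} := by
  obtain ⟨q, q', hne, heq, -, -⟩ := h.crossTwice
  intro hp
  rw [heq] at hp
  have h1 : q ∈ ({p} : Set (ℝ × ℝ)) := hp ▸ Set.mem_insert q _
  have h2 : q' ∈ ({p} : Set (ℝ × ℝ)) := hp ▸ Set.mem_insert_of_mem q rfl
  exact hne (h1.trans h2.symm)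

/-- A family of circles in which any two are tangent or cross, no three have a common point, and
no three are pairwise tangent. -/
structure IsArrangement {n : ℕ} (c : Fin n → SignedCircle ℝ) : Prop where
  radius_ne_zero : ∀ i, (c i).r ≠ 0
  tangent_or_crosses : ∀ i j, i ≠ j → Tangent (c i) (c j) ∨ Crosses (c i) (c j)
  not_mem_three : ∀ i j k, i ≠ j → j ≠ k → i ≠ k → ∀ z ∈ (c i).curve, z ∈ (c j).curve →
    z ∉ (c k).curve
  no_triangle : ∀ i j k, i ≠ j → j ≠ k → i ≠ k → Tangent (c i) (c j) → Tangent (c j) (c k) →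
    ¬ Tangent (c i) (c k)

namespace IsArrangement

variable {n : ℕ} {c : Fin n → SignedCircle ℝ}

theorem touch_iff (h : IsArrangement c) {i j : Fin n} (hij : i ≠ j) :
    Touch (c i).curve (c j).curve ↔ Tangent (c i) (c j) := by
  refine ⟨fun ⟨p, hp, _⟩ => ?_, fun ht => ht.touch (h.radius_ne_zero i) (h.radius_ne_zero j)⟩
  exact (h.tangent_or_crosses i j hij).resolve_right fun hc => not_touch_of_crosses hc p hp

theorem isSimpleArrangement (h : IsArrangement c) :
    IsSimpleArrangement fun i => (c i).curve where
  isSimpleClosedCurve i := isSimpleClosedCurve_curve (h.radius_ne_zero i)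
  touch_or_crossTwice i j hij := (h.tangent_or_crosses i j hij).imp
    (fun ht => ht.touch (h.radius_ne_zero i) (h.radius_ne_zero j)) Crosses.crossTwice
  no_triple_point i j k hij hjk hik := by
    rw [Set.eq_empty_iff_forall_notMem]
    rintro z ⟨⟨hi, hj⟩, hk⟩
    exact h.not_mem_three i j k hij hjk hik z hi hj hk

theorem cliqueFree (h : IsArrangement c) :
    (touchingGraph fun i => (c i).curve).CliqueFree 3 := by
  intro s hs
  obtain ⟨i, j, k, hij, hik, hjk, -⟩ := SimpleGraph.is3Clique_iff.1 hs
  exact h.no_triangle i j k hij.1 hjk.1 hik.1 ((h.touch_iff hij.1).1 hij.2)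
    ((h.touch_iff hjk.1).1 hjk.2) ((h.touch_iff hik.1).1 hik.2)

/-- Touchings correspond to tangent pairs, since no point is on three circles. -/
theorem ncard_touchings (h : IsArrangement c) :
    (touchings fun i => (c i).curve).ncard
      = {e : Fin n × Fin n | e.1 < e.2 ∧ Tangent (c e.1) (c e.2)}.ncard := by
  have hex : ∀ e ∈ {e : Fin n × Fin n | e.1 < e.2 ∧ Tangent (c e.1) (c e.2)},
      Touch (c e.1).curve (c e.2).curve := fun e he => (h.touch_iff he.1.ne).2 he.2
  choose! f hf hf' using hex
  have hmem : ∀ e ∈ {e : Fin n × Fin n | e.1 < e.2 ∧ Tangent (c e.1) (c e.2)},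
      f e ∈ (c e.1).curve ∧ f e ∈ (c e.2).curve := fun e he => by
    have : f e ∈ (c e.1).curve ∩ (c e.2).curve := by rw [hf e he]; rfl
    exact this
  have himage : (touchings fun i => (c i).curve)
      = f '' {e : Fin n × Fin n | e.1 < e.2 ∧ Tangent (c e.1) (c e.2)} := by
    ext p
    constructor
    · rintro ⟨i, j, hij, hp, ht⟩
      have hT : Tangent (c i) (c j) := (h.touch_iff hij).1 ⟨p, hp, ht⟩
      rcases lt_or_gt_of_ne hij with hlt | hlt
      · exact ⟨(i, j), ⟨hlt, hT⟩, Set.singleton_injective ((hf (i, j) ⟨hlt, hT⟩).symm.trans hp)⟩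
      · refine ⟨(j, i), ⟨hlt, hT.symm⟩, Set.singleton_injective
          ((hf (j, i) ⟨hlt, hT.symm⟩).symm.trans ?_)⟩
        rw [Set.inter_comm]; exact hp
    · rintro ⟨e, he, rfl⟩
      exact ⟨e.1, e.2, he.1.ne, hf e he, hf' e he⟩
  rw [himage]
  refine Set.InjOn.ncard_image ?_
  rintro ⟨i, j⟩ he ⟨k, l⟩ he' heq
  obtain ⟨hi, hj⟩ := hmem _ he
  obtain ⟨hk, hl⟩ := hmem _ he'
  rw [← heq] at hk hl
  have hij : i < j := he.1
  have hkl : k < l := he'.1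
  have two (m : Fin n) (hm : f (i, j) ∈ (c m).curve) : m = i ∨ m = j := by
    by_contra! hne
    exact h.not_mem_three i j m hij.ne hne.2.symm hne.1.symm _ hi hj hm
  rcases two k hk with rfl | rfl <;> rcases two l hl with rfl | rfl
  · exact absurd hkl (lt_irrefl _)
  · rfl
  · exact absurd (hij.trans hkl) (lt_irrefl _)
  · exact absurd hkl (lt_irrefl _)

/-- A new circle that is tangent to exactly two circles of an arrangement, which are not tangent
to each other, adds two touchings and no triangle. -/
theorem cons (h : IsArrangement c) {d : SignedCircle ℝ} (hd : d.r ≠ 0) {a b : Fin n}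
    (hab : a ≠ b) (hcr : Crosses (c a) (c b)) (ha : Tangent (c a) d) (hb : Tangent (c b) d)
    (hother : ∀ i, i ≠ a → i ≠ b → Crosses (c i) d)
    (havoid : ∀ i j, i ≠ j → ∀ z ∈ (c i).curve, z ∈ (c j).curve → z ∉ d.curve) :
    IsArrangement (Fin.cons d c : Fin (n + 1) → SignedCircle ℝ) ∧
      ((touchings fun i => (c i).curve).Finite →
        (touchings fun i => ((Fin.cons d c : Fin (n + 1) → SignedCircle ℝ) i).curve).ncard
          = (touchings fun i => (c i).curve).ncard + 2) := by
  have hrel (i : Fin n) : Tangent (c i) d ∨ Crosses (c i) d := by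
    by_cases hia : i = a
    · exact Or.inl (hia ▸ ha)
    by_cases hib : i = b
    · exact Or.inl (hib ▸ hb)
    exact Or.inr (hother i hia hib)
  have hnt {e e' : SignedCircle ℝ} (h1 : Crosses e e') (h2 : Tangent e e') : False := by
    unfold Crosses at h1
    rw [h2.1] at h1
    linarith [show (2 * e.r * e'.r) ^ 2 = 4 * e.r ^ 2 * e'.r ^ 2 by ring]
  have htan (i : Fin n) (hi : Tangent (c i) d) : i = a ∨ i = b := by
    by_contra! hne
    exact hnt (hother i hne.1 hne.2) hi
  have htri (i j : Fin n) (hij : i ≠ j) (hi : Tangent (c i) d) (hj : Tangent (c j) d) :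
      ¬ Tangent (c i) (c j) := by
    intro ht
    rcases htan i hi with rfl | rfl <;> rcases htan j hj with rfl | rfl
    · exact hij rfl
    · exact hnt hcr ht
    · exact hnt hcr ht.symm
    · exact hij rfl
  refine ⟨⟨?_, ?_, ?_, ?_⟩, fun hfin => ?_⟩
  · exact Fin.cases hd h.radius_ne_zero
  · refine Fin.cases (Fin.cases ?_ fun j _ => ?_) fun i => Fin.cases (fun _ => ?_) fun j hij => ?_
    · exact fun h => absurd rfl h
    · exact (hrel j).imp Tangent.symm Crosses.symm
    · exact hrel i
    · exact h.tangent_or_crosses i j fun e => hij (e ▸ rfl)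
  · intro i j k
    cases i using Fin.cases <;> cases j using Fin.cases <;> cases k using Fin.cases <;>
      simp only [ne_eq, not_true_eq_false, IsEmpty.forall_iff, implies_true, Fin.cons_zero,
        Fin.cons_succ, Fin.succ_inj]
    · exact fun _ hjk _ z h1 h2 h3 => havoid _ _ hjk z h2 h3 h1
    · exact fun _ _ hik z h1 h2 h3 => havoid _ _ hik z h1 h3 h2
    · exact fun hij _ _ z h1 h2 h3 => havoid _ _ hij z h1 h2 h3
    · exact h.not_mem_three _ _ _
  · intro i j k
    cases i using Fin.cases <;> cases j using Fin.cases <;> cases k using Fin.cases <;>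
      simp only [ne_eq, not_true_eq_false, IsEmpty.forall_iff, implies_true, Fin.cons_zero,
        Fin.cons_succ, Fin.succ_inj]
    · exact fun _ hjk _ h1 h2 h3 => htri _ _ hjk h1.symm h3.symm h2
    · exact fun _ _ hik h1 h2 h3 => htri _ _ hik h1 h2.symm h3
    · exact fun hij _ _ h1 h2 h3 => htri _ _ hij h3 h2 h1
    · exact h.no_triangle _ _ _
  · obtain ⟨p, hp, hpt⟩ := ha.touch (h.radius_ne_zero a) hd
    obtain ⟨q, hq, hqt⟩ := hb.touch (h.radius_ne_zero b) hd
    have hpm : p ∈ (c a).curve ∩ d.curve := by rw [hp]; rfl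
    have hqm : q ∈ (c b).curve ∩ d.curve := by rw [hq]; rfl
    have hd' {z} (hz : z ∈ touchings fun i => (c i).curve) : z ∉ d.curve := by
      obtain ⟨i, j, hij, hz, -⟩ := hz
      have : z ∈ (c i).curve ∩ (c j).curve := by rw [hz]; rfl
      exact havoid i j hij z this.1 this.2
    have hpq : p ≠ q := by
      rintro rfl
      exact havoid a b hab p hpm.1 hqm.1 hpm.2
    have key : (touchings fun i => ((Fin.cons d c : Fin (n + 1) → SignedCircle ℝ) i).curve)
        = insert p (insert q (touchings fun i => (c i).curve)) := by
      have new (i : Fin n) (z : ℝ × ℝ) (hz : (c i).curve ∩ d.curve = {z}) : z = p ∨ z = q := by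
        have hT := (hrel i).resolve_right fun hc => not_touch_of_crosses hc z hz
        rcases htan i hT with rfl | rfl
        · exact Or.inl (Set.singleton_injective (hz.symm.trans hp))
        · exact Or.inr (Set.singleton_injective (hz.symm.trans hq))
      ext z
      simp only [Set.mem_insert_iff]
      constructor
      · rintro ⟨i, j, hij, hz, ht⟩
        cases i using Fin.cases with
        | zero =>
          cases j using Fin.cases with
          | zero => exact absurd rfl hij
          | succ j =>
            have := new j z (by rw [Set.inter_comm]; exact hz)
            tauto
        | succ i =>
          cases j using Fin.cases with
          | zero =>
            have := new i z hz
            tauto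
          | succ j => exact Or.inr (Or.inr ⟨i, j, fun e => hij (e ▸ rfl), hz, ht⟩)
      · rintro (rfl | rfl | ⟨i, j, hij, hz, ht⟩)
        · exact ⟨a.succ, 0, Fin.succ_ne_zero a, hp, hpt⟩
        · exact ⟨b.succ, 0, Fin.succ_ne_zero b, hq, hqt⟩
        · exact ⟨i.succ, j.succ, fun e => hij (Fin.succ_inj.1 e), hz, ht⟩
    rw [key, Set.ncard_insert_of_notMem _ (hfin.insert _),
      Set.ncard_insert_of_notMem (fun hq' => hd' hq' hqm.2) hfin]
    rintro (hpq' | hp')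
    · exact hpq hpq'
    · exact hd' hp' hpm.2

end IsArrangement

/-! ### A pencil of circles -/

/-- The circle with centre `(0, t)` that is externally tangent to the circles of radius `3 / 2`
with centres `(± 1, -3 / 2)`. -/
noncomputable def pencil (t : ℝ) : SignedCircle ℝ := ⟨0, t, √(1 + (t + 3 / 2) ^ 2) - 3 / 2⟩

theorem pencil_eq {t s : ℝ} (hs : 0 ≤ s + 3 / 2) (h : (s + 3 / 2) ^ 2 = 1 + (t + 3 / 2) ^ 2) :
    pencil t = ⟨0, t, s⟩ := by
  rw [pencil, ← h, Real.sqrt_sq hs, add_sub_cancel_right]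

theorem pencil_r_add_sq (t : ℝ) : ((pencil t).r + 3 / 2) ^ 2 = 1 + (t + 3 / 2) ^ 2 := by
  simp only [pencil, sub_add_cancel]
  exact Real.sq_sqrt (by positivity)

theorem pencil_r_add_pos (t : ℝ) : 0 < (pencil t).r + 3 / 2 := by
  simp only [pencil, sub_add_cancel]
  positivity

theorem le_pencil_r {t : ℝ} (ht : 3 / 28 ≤ t) : 11 / 28 ≤ (pencil t).r := by
  nlinarith [pencil_r_add_sq t, pencil_r_add_pos t]

theorem tangent_pencil {t u : ℝ} (hu : u ^ 2 = 1) : Tangent ⟨u, -3 / 2, 3 / 2⟩ (pencil t) := by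
  have h := pencil_r_add_sq t
  have h' := pencil_r_add_pos t
  refine ⟨?_, by simp only; linarith⟩
  simp only [gap]
  rw [show (pencil t).x = 0 from rfl, show (pencil t).y = t from rfl]
  linear_combination hu - h

theorem crosses_of_abs_gap_lt {c d : SignedCircle ℝ} (h : |gap c d| < 2 * (c.r * d.r)) :
    Crosses c d := by
  unfold Crosses
  have := sq_lt_sq' (abs_lt.1 h).1 (abs_lt.1 h).2
  linarith [show (2 * (c.r * d.r)) ^ 2 = 4 * c.r ^ 2 * d.r ^ 2 by ring]

/-- Two circles of the pencil cross, if they are not too far from each other: their radii differ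
by less than the distance of their centres, as `√(1 + t²)` is a strict contraction in `t`. -/
theorem crosses_pencil {s t : ℝ} (hst : s ≠ t) (hs : 3 / 28 ≤ s) (hs' : s ≤ 3 / 28 + 3 / 4)
    (ht : 3 / 28 ≤ t) (ht' : t ≤ 3 / 28 + 3 / 4) : Crosses (pencil s) (pencil t) := by
  have hs1 := pencil_r_add_sq s
  have ht1 := pencil_r_add_sq t
  have hs2 := le_pencil_r hs
  have ht2 := le_pencil_r ht
  have hgap : gap (pencil s) (pencil t) = (s - t) ^ 2 - (pencil s).r ^ 2 - (pencil t).r ^ 2 := by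
    simp [gap, pencil]
  apply crosses_of_abs_gap_lt
  rw [hgap, abs_lt]
  generalize (pencil s).r = a at *
  generalize (pencil t).r = b at *
  have hst2 : 0 < (s - t) ^ 2 := by
    have : s - t ≠ 0 := sub_ne_zero.2 hst
    positivity
  constructor
  · have h1 : 1 + (s + 3 / 2) * (t + 3 / 2) < (a + 3 / 2) * (b + 3 / 2) := by
      apply lt_of_pow_lt_pow_left₀ 2 (by positivity)
      rw [mul_pow, hs1, ht1]
      nlinarith
    nlinarith
  · have h1 : (s - t) ^ 2 < (a + b) ^ 2 := by
      apply sq_lt_sq'  <;> linarith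
    nlinarith

theorem continuous_pencil_r : Continuous fun t => (pencil t).r := by
  unfold pencil
  fun_prop

theorem finite_setOf_quadratic_eq_zero {a b c : ℝ} (h : ¬ (a = 0 ∧ b = 0 ∧ c = 0)) :
    {t : ℝ | a * t ^ 2 + b * t + c = 0}.Finite := by
  open Polynomial in
  let P : ℝ[X] := C a * X ^ 2 + C b * X + C c
  have hP : P ≠ 0 := by
    intro hP
    have h0 := congrArg (Polynomial.coeff · 0) hP
    have h1 := congrArg (Polynomial.coeff · 1) hP
    have h2 := congrArg (Polynomial.coeff · 2) hP
    simp [P, Polynomial.coeff_X, Polynomial.coeff_C] at h0 h1 h2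
    exact h ⟨h2, h1, h0⟩
  refine P.roots.toFinset.finite_toSet.subset fun t ht => ?_
  simpa [hP, P] using ht

/-- At most finitely many circles of the pencil pass through a given point. -/
theorem finite_setOf_mem_pencil (z : ℝ × ℝ) : {t | z ∈ (pencil t).curve}.Finite := by
  -- Eliminating the radius from the equations of the point and of the radius leaves
  -- `(A + B t)² = 9 (1 + (t + 3 / 2)²)`.
  set A : ℝ := z.1 ^ 2 + z.2 ^ 2 - 11 / 2 with hA
  set B : ℝ := -(2 * z.2 + 3) with hB
  refine (finite_setOf_quadratic_eq_zero (a := B ^ 2 - 9) (b := 2 * A * B - 27)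
    (c := A ^ 2 - 9 - 81 / 4) ?_).subset fun t ht => ?_
  · rintro ⟨h1, h2, h3⟩
    nlinarith
  · have h1 := pencil_r_add_sq t
    have h2 : (z.1 - 0) ^ 2 + (z.2 - t) ^ 2 - (pencil t).r ^ 2 = 0 := ht
    have h3 : A + B * t = -(3 * ((pencil t).r + 3 / 2)) := by
      rw [hA, hB]
      linear_combination h2 + h1
    have h4 : (A + B * t) ^ 2 = 9 * (1 + (t + 3 / 2) ^ 2) := by
      rw [h3, ← h1]; ring
    show (B ^ 2 - 9) * t ^ 2 + (2 * A * B - 27) * t + (A ^ 2 - 9 - 81 / 4) = 0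
    linear_combination h4

/-! ### The Grötzsch graph as a touching graph -/

/-- Eleven circles whose touching graph is the Grötzsch graph, symmetric in the vertical axis.
The circles `0, …, 4` form a cycle of touching circles, the circle `5 + i` touches the two
neighbours of `i` in this cycle, and the circle `10` touches the circles `5, …, 9`. As it encloses
them, its radius is negative. -/
def groetzsch : Fin 11 → SignedCircle ℚ :=
  ![⟨0, 17001 / 21244, 21419 / 21244⟩,
    ⟨-1, -3 / 2, 3 / 2⟩,
    ⟨1, 0, 1⟩,
    ⟨-1, 0, 1⟩,
    ⟨1, -3 / 2, 3 / 2⟩,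
    ⟨0, 3 / 28, 11 / 28⟩,
    ⟨-1872 / 25939, -33867 / 103756, 12529 / 103756⟩,
    ⟨13 / 113, -32 / 113, 17 / 113⟩,
    ⟨-13 / 113, -32 / 113, 17 / 113⟩,
    ⟨1872 / 25939, -33867 / 103756, 12529 / 103756⟩,
    ⟨0, 1 / 44, -21 / 44⟩]

theorem isArrangement_groetzsch : IsArrangement fun i => (groetzsch i).toReal where
  radius_ne_zero i := by
    have : ∀ i, (groetzsch i).r ≠ 0 := by decide +kernel
    simpa [toReal] using this i
  tangent_or_crosses i j hij := by
    have : ∀ i j, i ≠ j → Tangent (groetzsch i) (groetzsch j) ∨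
        Crosses (groetzsch i) (groetzsch j) := by decide +kernel
    rw [tangent_toReal, crosses_toReal]
    exact this i j hij
  not_mem_three i j k hij hjk hik z hi hj hk := by
    have : ∀ i j k, i ≠ j → j ≠ k → i ≠ k →
        concurrence (groetzsch i) (groetzsch j) (groetzsch k) ≠ 0 := by decide +kernel
    exact this i j k hij hjk hik (concurrence_eq_zero hi hj hk)
  no_triangle i j k _ _ _ := by
    have : ∀ i j k, Tangent (groetzsch i) (groetzsch j) → Tangent (groetzsch j) (groetzsch k) →
        ¬ Tangent (groetzsch i) (groetzsch k) := by decide +kernel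
    simp only [tangent_toReal]
    exact this i j k

theorem ncard_touchings_groetzsch :
    (touchings fun i => (groetzsch i).toReal.curve).ncard = 20 := by
  rw [isArrangement_groetzsch.ncard_touchings]
  simp only [tangent_toReal]
  rw [Set.ncard_eq_toFinset_card']
  have : (Finset.univ.filter fun e : Fin 11 × Fin 11 =>
      e.1 < e.2 ∧ Tangent (groetzsch e.1) (groetzsch e.2)).card = 20 := by decide +kernel
  rw [← this]
  congr 1
  ext e
  simp

theorem groetzsch_one : (groetzsch 1).toReal = ⟨-1, -3 / 2, 3 / 2⟩ := by
  rw [show groetzsch 1 = ⟨-1, -3 / 2, 3 / 2⟩ from rfl]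
  norm_num [toReal]

theorem groetzsch_four : (groetzsch 4).toReal = ⟨1, -3 / 2, 3 / 2⟩ := by
  rw [show groetzsch 4 = ⟨1, -3 / 2, 3 / 2⟩ from rfl]
  norm_num [toReal]

theorem groetzsch_zero : (groetzsch 0).toReal = pencil (17001 / 21244) := by
  rw [pencil_eq (s := 21419 / 21244) (by norm_num) (by norm_num)]
  rw [show groetzsch 0 = ⟨0, 17001 / 21244, 21419 / 21244⟩ from rfl]
  norm_num [toReal]

theorem groetzsch_five : (groetzsch 5).toReal = pencil (3 / 28) := by
  rw [pencil_eq (s := 11 / 28) (by norm_num) (by norm_num)]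
  rw [show groetzsch 5 = ⟨0, 3 / 28, 11 / 28⟩ from rfl]
  norm_num [toReal]

theorem groetzsch_ten : (groetzsch 10).toReal = ⟨0, 1 / 44, -21 / 44⟩ := by
  rw [show groetzsch 10 = ⟨0, 1 / 44, -21 / 44⟩ from rfl]
  norm_num [toReal]

/-- The circles of the pencil just above circle `5` cross all circles of the arrangement but the
two base circles of the pencil. -/
theorem eventually_crosses_groetzsch {i : Fin 11} (h1 : i ≠ 1) (h4 : i ≠ 4) :
    ∀ᶠ t in 𝓝[>] (3 / 28 : ℝ), Crosses (groetzsch i).toReal (pencil t) := by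
  by_cases h0 : i = 0
  · subst h0
    filter_upwards [Ioo_mem_nhdsGT (show (3 / 28 : ℝ) < 1 / 2 by norm_num)] with t ht
    rw [groetzsch_zero]
    apply crosses_pencil <;> linarith [ht.1, ht.2]
  by_cases h5 : i = 5
  · subst h5
    filter_upwards [Ioo_mem_nhdsGT (show (3 / 28 : ℝ) < 1 / 2 by norm_num)] with t ht
    rw [groetzsch_five]
    apply crosses_pencil <;> linarith [ht.1, ht.2]
  by_cases h10 : i = 10
  · subst h10
    filter_upwards [Ioo_mem_nhdsGT (show (3 / 28 : ℝ) < 5 / 28 by norm_num)] with t ht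
    rw [groetzsch_ten]
    have e1 := pencil_r_add_sq t
    have e2 := le_pencil_r ht.1.le
    have hgap : gap ⟨0, 1 / 44, -21 / 44⟩ (pencil t)
        = (1 / 44 - t) ^ 2 - (21 / 44) ^ 2 - (pencil t).r ^ 2 := by
      simp [gap, pencil]; ring
    unfold Crosses
    rw [hgap]
    generalize (pencil t).r = s at *
    have e3 : s < 21 / 44 := by nlinarith [ht.1, ht.2]
    -- The highest point of the new circle is above the one of circle `10`.
    have e4 : 1 / 2 < t + s := by nlinarith [ht.1, ht.2]
    have e5 : 0 < (t - 1 / 44) ^ 2 - (21 / 44 - s) ^ 2 := by nlinarith [ht.1, ht.2]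
    have e6 : 0 < (21 / 44 + s) ^ 2 - (t - 1 / 44) ^ 2 := by nlinarith [ht.1, ht.2]
    nlinarith [mul_pos e5 e6]
  · have hc : ∀ i : Fin 11, i ≠ 1 → i ≠ 4 → i ≠ 0 → i ≠ 5 → i ≠ 10 →
        Crosses (groetzsch i) (groetzsch 5) := by decide +kernel
    have h := crosses_toReal.2 (hc i h1 h4 h0 h5 h10)
    rw [groetzsch_five] at h
    refine nhdsWithin_le_nhds ?_
    have hr := continuous_pencil_r
    have hgap : Continuous fun t => gap (groetzsch i).toReal (pencil t) := by
      simp only [gap]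
      simp only [show ∀ t, (pencil t).x = 0 from fun _ => rfl,
        show ∀ t, (pencil t).y = t from fun _ => rfl]
      fun_prop
    exact ContinuousAt.eventually_lt (f := fun t => gap (groetzsch i).toReal (pencil t) ^ 2)
      (g := fun t => 4 * (groetzsch i).toReal.r ^ 2 * (pencil t).r ^ 2)
      (hgap.pow 2).continuousAt (continuous_const.mul (hr.pow 2)).continuousAt h

/-- For every `n ≥ 11` there is an arrangement with `2n - 2` touchings that contains the two base
circles of the pencil, and in which almost all circles of the pencil just above circle `5` cross
all other circles: the circles beyond the first eleven are such circles themselves. -/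
theorem exists_isArrangement (m : ℕ) : ∃ c : Fin (11 + m) → SignedCircle ℝ, IsArrangement c ∧
    (touchings fun i => (c i).curve).ncard = 20 + 2 * m ∧
    ∃ a b, a ≠ b ∧ c a = ⟨-1, -3 / 2, 3 / 2⟩ ∧ c b = ⟨1, -3 / 2, 3 / 2⟩ ∧
      ∀ i, i ≠ a → i ≠ b → ∀ᶠ t in 𝓝[>] (3 / 28 : ℝ), Crosses (c i) (pencil t) := by
  induction m with
  | zero =>
    exact ⟨_, isArrangement_groetzsch, ncard_touchings_groetzsch, 1, 4, by decide, groetzsch_one,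
      groetzsch_four, fun i => eventually_crosses_groetzsch⟩
  | succ m ih =>
    obtain ⟨c, hc, hcard, a, b, hab, ha, hb, hother⟩ := ih
    have hcross : Crosses (c a) (c b) := by
      rw [ha, hb]
      norm_num [Crosses, gap]
    have hfin (i j : Fin (11 + m)) (hij : i ≠ j) : ((c i).curve ∩ (c j).curve).Finite := by
      rcases hc.isSimpleArrangement.touch_or_crossTwice i j hij with
        ⟨p, hp, -⟩ | ⟨p, q, -, hp, -⟩
      · rw [hp]; exact Set.finite_singleton p
      · rw [hp]; exact Set.toFinite _
    have havoid : ∀ᶠ t in 𝓝[>] (3 / 28 : ℝ), ∀ i j, i ≠ j →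
        ∀ z ∈ (c i).curve, z ∈ (c j).curve → z ∉ (pencil t).curve := by
      simp only [eventually_all]
      intro i j hij
      have h1 : ∀ᶠ t in 𝓝[>] (3 / 28 : ℝ), ∀ z ∈ (c i).curve ∩ (c j).curve,
          z ∉ (pencil t).curve := by
        rw [eventually_all_finite (hfin i j hij)]
        intro z _
        have h2 := ((finite_setOf_mem_pencil z).subset
          (Set.inter_subset_left (t := {t | t ≠ 3 / 28}))).isClosed.isOpen_compl
        have h3 : ∀ᶠ t in 𝓝[>] (3 / 28 : ℝ), t ∈ ({t | z ∈ (pencil t).curve} ∩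
            {t | t ≠ 3 / 28})ᶜ :=
          nhdsWithin_le_nhds (h2.mem_nhds (by simp))
        filter_upwards [h3, self_mem_nhdsWithin] with t ht ht' hz
        exact ht ⟨hz, (Set.mem_Ioi.1 ht').ne'⟩
      exact h1.mono fun t ht z hi hj => ht z ⟨hi, hj⟩
    have hall : ∀ᶠ t in 𝓝[>] (3 / 28 : ℝ), ∀ i, i ≠ a → i ≠ b → Crosses (c i) (pencil t) := by
      simpa only [eventually_all] using hother
    obtain ⟨t, ht1, ht2, ht3⟩ := (havoid.and (hall.and
      (Ioo_mem_nhdsGT (show (3 / 28 : ℝ) < 1 / 2 by norm_num)))).exists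
    obtain ⟨hA, hC⟩ := hc.cons (by linarith [le_pencil_r ht3.1.le]) hab hcross
      (by rw [ha]; exact tangent_pencil (by norm_num))
      (by rw [hb]; exact tangent_pencil (by norm_num)) ht2 ht1
    refine ⟨Fin.cons (pencil t) c, hA, ?_, a.succ, b.succ, fun e => hab (Fin.succ_inj.1 e),
      by simpa using ha, by simpa using hb, ?_⟩
    · refine (hC (Set.finite_of_ncard_ne_zero (by omega))).trans ?_
      rw [hcard]
      ring
    · refine Fin.cases (fun _ _ => ?_) fun i hia hib => ?_
      · filter_upwards [Ioo_mem_nhdsGT ht3.1] with s hs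
        apply crosses_pencil <;> linarith [hs.1, hs.2, ht3.1, ht3.2]
      · exact hother i (fun e => hia (e ▸ rfl)) fun e => hib (e ▸ rfl)

end SignedCircle

theorem proposition2 (n : ℕ) (hn : n = 11 ∨ n = 14 ∨ n = 15 ∨ 17 ≤ n) :
    ∃ C : Fin n → Set (ℝ × ℝ), IsSimpleArrangement C ∧
      (touchingGraph C).CliqueFree 3 ∧ (touchings C).ncard = 2 * n - 2 := by
  obtain ⟨m, rfl⟩ : ∃ m, n = 11 + m := ⟨n - 11, by omega⟩
  obtain ⟨c, hc, hcard, -⟩ := SignedCircle.exists_isArrangement m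
  exact ⟨_, hc.isSimpleArrangement, hc.cliqueFree, by rw [hcard]; omega⟩
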